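/- Fix an integer $m\ge 1$. Let $\Sigma$ be a semianalytic manifold of class $C^m$ (a Hausdorff, second countable $C^m$ manifold of finite dimension whose coordinate changes are semianalytic), let $G$ be a compact connected Lie group, and let $\Pi:P\to\Sigma$ be a semianalytic principal $G$-bundle of class $C^m$. Here a map between open subsets of $\mathbb R^n$ and $\mathbb R^k$ is called semianalytic if every point of its domain has an open neighbourhood $U$ with finitely many real-analytic functions $h_1,\dots,h_N$ on $U$ such that on each set $\{x\in U: h_i(x)\,\sigma_i\,0\ \forall i\}$, $\sigma_i\in\{>,=,<\}$, the map coincides with a map that is analytic on all of $U$. Let $\mathcal A$ be the space of connections on $P$ (connection forms of class $C^{m-1}$). A semianalytic edge is a connected one-dimensional semianalytic submanifold of $\Sigma$ with two-point boundary; an edge is an oriented, embedded one-dimensional $C^0$ submanifold (an arc) with two-point boundary which is a finite union of semianalytic edges. For an edge $e$ from $x$ to $y$ let $\mathcal A_e$ be the set of $G$-equivariant maps $\Pi^{-1}(x)\to\Pi^{-1}(y)$; a choice of points $p_x\in\Pi^{-1}(x)$, $p_y\in\Pi^{-1}(y)$ identifies $\mathcal A_e$ with $G$, sending $f$ to the $g$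 with $f(p_x)=p_y g$, and the resulting manifold structure on $\mathcal A_e$ does not depend on the choice. Let $A(e)\in\mathcal A_e$ be the parallel transport of $A\in\mathcal A$ along $e$. A function $\Psi:\mathcal A\to\mathbb C$ is cylindrical if there are finitely many edges $e_1,\dots,e_n$ and $\psi\in C^\infty(\mathcal A_{e_1}\times\dots\times\mathcal A_{e_n})$ with $\Psi(A)=\psi(A(e_1),\dots,A(e_n))$ for all $A\in\mathcal A$. Let $\mathrm{Cyl}$ be the $*$-algebra of all cylindrical functions, with pointwise operations, $\Psi^*=\overline\Psi$ and the norm $\|\Psi\|=\sup_{A\in\mathcal A}|\Psi(A)|$, and let $\overline{\mathrm{Cyl}}$ be its completion, a unital $C^*$-algebra. Lemma. Let $\omega:\mathrm{Cyl}\to\mathbb C$ be a linear functional with $\omega(\overline\Psi)=\overline{\omega(\Psi)}$ and $\omega(\overline\Psi\,\Psi)\ge 0$ for all $\Psi\in\mathrm{Cyl}$, and $\omega(1)=1$. Then $$|\omega(\Psi)|\le 2\,\|\Psi\|\qquad\text{for all }\Psi\in\mathrm{Cyl}.$$ Therefore $\omega$ is continuous with respect to $\|\cdot\|$, and it has a unique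 extension to a state on $\overline{\mathrm{Cyl}}$, that is, there is exactly one linear functional $\overline\omega:\overline{\mathrm{Cyl}}\to\mathbb C$ with $\overline\omega(a^*)=\overline{\overline\omega(a)}$ and $\overline\omega(a^*a)\ge 0$ for all $a$, $\overline\omega(1)=1$, and $\overline\omega|_{\mathrm{Cyl}}=\omega$. -/

import Mathlib

open Set Topology
open scoped Manifold ContDiff RightActions

namespace HolonomyFlux

/-! ### Semianalytic functions and semianalytic manifolds -/

section Semianalytic

variable {E F H H' M N : Type*}
  [NormedAddCommGroup E] [NormedSpace ℝ E] [NormedAddCommGroup F] [NormedSpace ℝ F]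
  [TopologicalSpace H] [TopologicalSpace H']
  [TopologicalSpace M] [ChartedSpace H M] [TopologicalSpace N] [ChartedSpace H' N]

/-- `f` is semianalytic on the open set `U`: every point of `U` has an open neighbourhood `V`
carrying finitely many real analytic functions `h₁, …, h_N` such that on each of the pieces of `V`
cut out by prescribing the sign (`>`, `=`, `<`) of every `h_i`, the function `f` coincides with
a function analytic on all of `V`. -/
def SemianalyticOn (f : E → F) (U : Set E) : Prop :=
  ∀ x ∈ U, ∃ V : Set E, IsOpen V ∧ x ∈ V ∧ V ⊆ U ∧
    ∃ (N : ℕ) (h : Fin N → E → ℝ), (∀ i, AnalyticOnNhd ℝ (h i) V) ∧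
      ∀ σ : Fin N → SignType, ∃ fσ : E → F, AnalyticOnNhd ℝ fσ V ∧
        ∀ y ∈ V, (∀ i, SignType.sign (h i y) = σ i) → f y = fσ y

/-- A map between charted spaces is semianalytic and `C^m` on the open set `s`, i.e. it is `C^m`
there, and all its representatives in the charts of the two atlases are semianalytic. -/
def SemianalyticMapOn (I : ModelWithCorners ℝ E H) (J : ModelWithCorners ℝ F H') (m : ℕ)
    (f : M → N) (s : Set M) : Prop :=
  ContMDiffOn I J m f s ∧
    ∀ φ ∈ atlas H M, ∀ χ ∈ atlas H' N,
      SemianalyticOn (χ.extend J ∘ f ∘ (φ.extend I).symm)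
        ((φ.extend I).target ∩ (φ.extend I).symm ⁻¹' (s ∩ f ⁻¹' χ.source))

/-- A `C^m` manifold with an atlas whose coordinate changes are moreover semianalytic. -/
class SemianalyticManifold (I : ModelWithCorners ℝ E H) (m : ℕ) (M : Type*)
    [TopologicalSpace M] [ChartedSpace H M] : Prop extends IsManifold I m M where
  semianalytic_compatible : ∀ φ ∈ atlas H M, ∀ χ ∈ atlas H M,
    SemianalyticOn (χ.extend I ∘ (φ.extend I).symm)
      ((φ.extend I).target ∩ (φ.extend I).symm ⁻¹' χ.source)

/-- `χ` belongs to the maximal semianalytic `C^m` atlas. -/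
def IsSemianalyticChart (I : ModelWithCorners ℝ E H) (m : ℕ)
    (χ : OpenPartialHomeomorph M H) : Prop :=
  χ ∈ IsManifold.maximalAtlas I m M ∧
    ∀ φ ∈ atlas H M,
      SemianalyticOn (χ.extend I ∘ (φ.extend I).symm)
        ((φ.extend I).target ∩ (φ.extend I).symm ⁻¹' χ.source) ∧
      SemianalyticOn (φ.extend I ∘ (χ.extend I).symm)
        ((χ.extend I).target ∩ (χ.extend I).symm ⁻¹' φ.source)

end Semianalytic

/-! ### Semianalytic submanifolds with boundary and edges -/

/-- `{x ∈ ℝ^D : x¹ = … = x^{D-k} = 0, 0 < x^{D-k+1} < 1, …, 0 < x^D < 1}`. -/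
def openSlice (D k : ℕ) : Set (EuclideanSpace ℝ (Fin D)) :=
  {x | (∀ i : Fin D, (i : ℕ) + k < D → x i = 0) ∧
    ∀ i : Fin D, D ≤ (i : ℕ) + k → 0 < x i ∧ x i < 1}

/-- `{x ∈ ℝ^D : x¹ = … = x^{D-k} = 0, 0 ≤ x^{D-k+1} < 1, 0 < x^{D-k+2} < 1, …, 0 < x^D < 1}`. -/
def halfSlice (D k : ℕ) : Set (EuclideanSpace ℝ (Fin D)) :=
  {x | (∀ i : Fin D, (i : ℕ) + k < D → x i = 0) ∧
    (∀ i : Fin D, (i : ℕ) + k = D → 0 ≤ x i ∧ x i < 1) ∧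
    ∀ i : Fin D, D < (i : ℕ) + k → 0 < x i ∧ x i < 1}

section Edges

variable {D : ℕ} {M : Type*} [TopologicalSpace M] [ChartedSpace (EuclideanSpace ℝ (Fin D)) M]

/-- `S` is a `k`-dimensional semianalytic (`C^m`) submanifold with boundary of the `D`-dimensional
manifold `M`. -/
def IsSubmanifoldWithBoundary (D m k : ℕ) {M : Type*} [TopologicalSpace M]
    [ChartedSpace (EuclideanSpace ℝ (Fin D)) M] (S : Set M) : Prop :=
  k ≤ D ∧ ∀ x ∈ S, ∃ χ : OpenPartialHomeomorph M (EuclideanSpace ℝ (Fin D)),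
    IsSemianalyticChart (𝓡 D) m χ ∧ x ∈ χ.source ∧
      (χ '' (S ∩ χ.source) = openSlice D k ∨ χ '' (S ∩ χ.source) = halfSlice D k)

/-- The boundary points of a `k`-dimensional submanifold with boundary `S`. -/
def submanifoldBoundary (D m k : ℕ) {M : Type*} [TopologicalSpace M]
    [ChartedSpace (EuclideanSpace ℝ (Fin D)) M] (S : Set M) : Set M :=
  {x | x ∈ S ∧ ∃ χ : OpenPartialHomeomorph M (EuclideanSpace ℝ (Fin D)),
    IsSemianalyticChart (𝓡 D) m χ ∧ x ∈ χ.source ∧ χ '' (S ∩ χ.source) = halfSlice D k ∧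
      ∃ i : Fin D, (i : ℕ) + k = D ∧ χ x i = 0}

/-- A semianalytic edge: a connected `1`-dimensional semianalytic submanifold with two-point
boundary. -/
def IsSemianalyticEdge (D m : ℕ) {M : Type*} [TopologicalSpace M]
    [ChartedSpace (EuclideanSpace ℝ (Fin D)) M] (S : Set M) : Prop :=
  IsSubmanifoldWithBoundary D m 1 S ∧ IsConnected S ∧ (submanifoldBoundary D m 1 S).ncard = 2

/-- An edge: an embedded arc (a connected `1`-dimensional `C⁰` submanifold with two boundary
points) which is a finite union of semianalytic edges. Its orientation is recorded by
saying which of the two boundary points is the beginning point and which is the end point. -/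
structure Edge (D m : ℕ) (M : Type*) [TopologicalSpace M]
    [ChartedSpace (EuclideanSpace ℝ (Fin D)) M] where
  carrier : Set M
  source : M
  target : M
  isArc : ∃ γ : unitInterval → M, IsEmbedding γ ∧ range γ = carrier ∧ γ 0 = source ∧ γ 1 = target
  isUnion : ∃ T : Set (Set M), T.Finite ∧ (∀ S ∈ T, IsSemianalyticEdge D m S) ∧ carrier = ⋃₀ T

/-- `γ : [0,1] → M` is a parametrization of the edge `e`, running from its beginning point to its
end point, which away from the finite set `B` of parameters is a `C¹` immersion. -/
def Edge.IsParametrization {m : ℕ} (e : Edge D m M) (γ : ℝ → M) (B : Set ℝ) : Prop :=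
  ContinuousOn γ (Icc 0 1) ∧ InjOn γ (Icc 0 1) ∧ γ '' Icc 0 1 = e.carrier ∧
    γ 0 = e.source ∧ γ 1 = e.target ∧ B.Finite ∧
    ∀ t ∈ Ioo (0 : ℝ) 1 \ B, ContMDiffAt 𝓘(ℝ, ℝ) (𝓡 D) 1 γ t ∧ mfderiv 𝓘(ℝ, ℝ) (𝓡 D) γ t ≠ 0

end Edges

/-! ### Principal bundles, connections and parallel transport -/

/-- A semianalytic (`C^m`) principal fibre bundle with structure group `G`, base `M`, total space
`P`; the right action of `G` on `P` is the given action of the opposite group `Gᵐᵒᵖ`. -/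
structure PrincipalBundle (m D d : ℕ) (G M P : Type*)
    [Group G] [TopologicalSpace G] [ChartedSpace (EuclideanSpace ℝ (Fin d)) G]
    [TopologicalSpace M] [ChartedSpace (EuclideanSpace ℝ (Fin D)) M]
    [TopologicalSpace P]
    [ChartedSpace (ModelProd (EuclideanSpace ℝ (Fin D)) (EuclideanSpace ℝ (Fin d))) P]
    [MulAction Gᵐᵒᵖ P] where
  proj : P → M
  proj_semianalytic : SemianalyticMapOn ((𝓡 D).prod (𝓡 d)) (𝓡 D) m proj univ
  proj_act : ∀ (p : P) (g : G), proj (p <• g) = proj p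
  locally_trivial : ∀ x : M, ∃ τ : Bundle.Trivialization G proj, x ∈ τ.baseSet ∧
    (∀ p ∈ τ.source, ∀ g : G, (τ (p <• g)).2 = (τ p).2 * g) ∧
    SemianalyticMapOn ((𝓡 D).prod (𝓡 d)) ((𝓡 D).prod (𝓡 d)) m τ τ.source ∧
    SemianalyticMapOn ((𝓡 D).prod (𝓡 d)) ((𝓡 D).prod (𝓡 d)) m
      τ.toOpenPartialHomeomorph.symm τ.target

/-- The adjoint action of a Lie group on its Lie algebra: the derivative at `1` of `h ↦ g h g⁻¹`. -/
noncomputable def adjointAction (d : ℕ) {G : Type*} [Group G] [TopologicalSpace G]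
    [ChartedSpace (EuclideanSpace ℝ (Fin d)) G] (g : G) :
    GroupLieAlgebra (𝓡 d) G →L[ℝ] GroupLieAlgebra (𝓡 d) G :=
  mfderiv (𝓡 d) (𝓡 d) (fun h : G => g * h * g⁻¹) 1

section Bundle

variable {m D d : ℕ} {G M P : Type*}
  [Group G] [TopologicalSpace G] [ChartedSpace (EuclideanSpace ℝ (Fin d)) G]
  [TopologicalSpace M] [ChartedSpace (EuclideanSpace ℝ (Fin D)) M]
  [TopologicalSpace P]
  [ChartedSpace (ModelProd (EuclideanSpace ℝ (Fin D)) (EuclideanSpace ℝ (Fin d))) P]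
  [MulAction Gᵐᵒᵖ P]

/-- A connection on the principal bundle, given by its connection form: a `C^{m-1}` one-form on
the total space with values in the Lie algebra `𝔤` of `G` which takes the value `ξ` on the
fundamental vector field of each `ξ ∈ 𝔤` and satisfies `R_g^* ω = Ad(g⁻¹) ω`. -/
structure Connection (𝔓 : PrincipalBundle m D d G M P) where
  form : ∀ p : P, TangentSpace ((𝓡 D).prod (𝓡 d)) p →L[ℝ] GroupLieAlgebra (𝓡 d) G
  /-- In the charts of `P` the coefficients of the form are of class `C^{m-1}`. -/
  contDiff : ∀ (p : P) (w : EuclideanSpace ℝ (Fin D) × EuclideanSpace ℝ (Fin d)),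
    ContDiffOn ℝ (F := EuclideanSpace ℝ (Fin d)) ((m - 1 : ℕ) : ℕ∞ω)
      (fun y => form ((extChartAt ((𝓡 D).prod (𝓡 d)) p).symm y)
        (mfderiv 𝓘(ℝ, EuclideanSpace ℝ (Fin D) × EuclideanSpace ℝ (Fin d)) ((𝓡 D).prod (𝓡 d))
          (extChartAt ((𝓡 D).prod (𝓡 d)) p).symm y w))
      (extChartAt ((𝓡 D).prod (𝓡 d)) p).target
  fundamental : ∀ (p : P) (ξ : GroupLieAlgebra (𝓡 d) G),
    form (p <• (1 : G)) (mfderiv (𝓡 d) ((𝓡 D).prod (𝓡 d)) (fun g : G => p <• g) 1 ξ) = ξ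
  equivariant : ∀ (p : P) (g : G) (v : TangentSpace ((𝓡 D).prod (𝓡 d)) p),
    form (p <• g)
      (mfderiv ((𝓡 D).prod (𝓡 d)) ((𝓡 D).prod (𝓡 d)) (fun q : P => q <• g) p v) =
      adjointAction d g⁻¹ (form p v)

namespace PrincipalBundle

variable (𝔓 : PrincipalBundle m D d G M P)

/-- The fibre of the bundle over `x`. -/
abbrev Fiber (x : M) : Type _ := {p : P // 𝔓.proj p = x}

/-- Bundle isomorphisms between the fibres over `x` and `y`, i.e. the maps that commute with the
right action of `G`. -/
structure FiberIso (x y : M) where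
  toFun : 𝔓.Fiber x → 𝔓.Fiber y
  equivariant : ∀ (p q : 𝔓.Fiber x) (g : G), (q : P) = (p : P) <• g →
    (toFun q : P) = (toFun p : P) <• g

variable {𝔓} in
theorem FiberIso.ext {x y : M} {f g : 𝔓.FiberIso x y} (h : ∀ p, f.toFun p = g.toFun p) :
    f = g := by
  cases f; cases g; congr; exact funext h

/-- `G` acts freely on the total space. -/
theorem act_free (𝔓 : PrincipalBundle m D d G M P) (p : P) {g h : G} (hgh : p <• g = p <• h) : g = h := by
  obtain ⟨τ, hx, hτ, -⟩ := 𝔓.locally_trivial (𝔓.proj p)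
  have hp : p ∈ τ.source := τ.mem_source.2 hx
  have := congrArg (fun q => (τ q).2) hgh
  simp only [hτ p hp] at this
  exact mul_left_cancel this

/-- `G` acts transitively on the fibres. -/
theorem act_transitive {p q : P} (h : 𝔓.proj q = 𝔓.proj p) : ∃ g : G, q = p <• g := by
  obtain ⟨τ, hx, hτ, -⟩ := 𝔓.locally_trivial (𝔓.proj p)
  have hp : p ∈ τ.source := τ.mem_source.2 hx
  have hq : q ∈ τ.source := τ.mem_source.2 (h ▸ hx)
  refine ⟨(τ p).2⁻¹ * (τ q).2, ?_⟩
  have hpg : p <• ((τ p).2⁻¹ * (τ q).2) ∈ τ.source :=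
    τ.mem_source.2 (by rw [𝔓.proj_act]; exact hx)
  refine τ.injOn hq hpg (Prod.ext ?_ ?_)
  · exact (τ.coe_fst hq).trans ((h.trans (𝔓.proj_act p _).symm).trans (τ.coe_fst hpg).symm)
  · exact (by rw [hτ p hp]; group : (τ q).2 = (τ (p <• ((τ p).2⁻¹ * (τ q).2))).2)

/-- No fibre is empty. -/
theorem fiber_nonempty (x : M) : Nonempty (𝔓.Fiber x) := by
  obtain ⟨τ, hx, -⟩ := 𝔓.locally_trivial x
  exact ⟨⟨τ.toOpenPartialHomeomorph.symm (x, 1), τ.proj_symm_apply' hx⟩⟩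

/-- The element `g` of `G` with `q = p g`, for two points `p, q` of the same fibre. -/
noncomputable def diff {x : M} (p q : 𝔓.Fiber x) : G :=
  (𝔓.act_transitive (p := (p : P)) (q := (q : P)) (q.2.trans p.2.symm)).choose

theorem act_diff {x : M} (p q : 𝔓.Fiber x) : (q : P) = (p : P) <• 𝔓.diff p q :=
  (𝔓.act_transitive (p := (p : P)) (q := (q : P)) (q.2.trans p.2.symm)).choose_spec

theorem diff_unique {x : M} {p q : 𝔓.Fiber x} {g : G} (h : (q : P) = (p : P) <• g) :
    𝔓.diff p q = g :=
  𝔓.act_free (p : P) ((𝔓.act_diff p q).symm.trans h)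

/-- The gauge map determined by `p_x` in the fibre over `x` and `p_y` in the fibre over `y`: it
identifies the set of bundle isomorphisms with `G`, an isomorphism `f` being sent to the
`g ∈ G` with `f(p_x) = p_y g`. -/
noncomputable def gaugeMap {x y : M} (px : 𝔓.Fiber x) (py : 𝔓.Fiber y) :
    𝔓.FiberIso x y ≃ G where
  toFun f := 𝔓.diff py (f.toFun px)
  invFun g :=
    { toFun := fun q => ⟨(py : P) <• (g * 𝔓.diff px q), (𝔓.proj_act _ _).trans py.2⟩
      equivariant := by
        intro p q h hq
        have h1 : 𝔓.diff px q = 𝔓.diff px p * h := by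
          refine 𝔓.diff_unique ?_
          rw [hq, MulOpposite.op_mul, mul_smul, ← 𝔓.act_diff px p]
        change (py : P) <• (g * 𝔓.diff px q) = ((py : P) <• (g * 𝔓.diff px p)) <• h
        rw [h1, ← mul_assoc, MulOpposite.op_mul, mul_smul] }
  left_inv f := by
    refine FiberIso.ext fun q => Subtype.ext ?_
    change (py : P) <• (𝔓.diff py (f.toFun px) * 𝔓.diff px q) = f.toFun q
    rw [f.equivariant px q _ (𝔓.act_diff px q), MulOpposite.op_mul, mul_smul,
      ← 𝔓.act_diff py (f.toFun px)]
  right_inv g := by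
    refine 𝔓.diff_unique ?_
    have h1 : 𝔓.diff px px = 1 := 𝔓.diff_unique (by simp)
    change (py : P) <• (g * 𝔓.diff px px) = (py : P) <• g
    rw [h1, mul_one]

instance (x y : M) : Nonempty (𝔓.FiberIso x y) :=
  ⟨(𝔓.gaugeMap (𝔓.fiber_nonempty x).some (𝔓.fiber_nonempty y).some).symm 1⟩

end PrincipalBundle

variable {𝔓 : PrincipalBundle m D d G M P}

/-- `c` is a horizontal lift of the path `γ : [0,1] → M` with exceptional parameters `B`. -/
def Connection.IsHorizontalLift (A : Connection 𝔓) (γ : ℝ → M) (B : Set ℝ) (c : ℝ → P) : Prop :=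
  ContinuousOn c (Icc 0 1) ∧ (∀ t ∈ Icc (0 : ℝ) 1, 𝔓.proj (c t) = γ t) ∧
    ∀ t ∈ Ioo (0 : ℝ) 1 \ B, MDifferentiableAt 𝓘(ℝ, ℝ) ((𝓡 D).prod (𝓡 d)) c t ∧
      A.form (c t) (mfderiv 𝓘(ℝ, ℝ) ((𝓡 D).prod (𝓡 d)) c t (1 : ℝ)) = 0

/-- `f` is the parallel transport along the edge `e`: for some parametrization of `e`, every point
`p` of the fibre over the beginning point is the initial point of a horizontal lift which
ends at `f p`. -/
def Connection.IsParallelTransport (A : Connection 𝔓) (e : Edge D m M)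
    (f : 𝔓.FiberIso e.source e.target) : Prop :=
  ∃ (γ : ℝ → M) (B : Set ℝ), e.IsParametrization γ B ∧
    ∀ p : 𝔓.Fiber e.source, ∃ c : ℝ → P, A.IsHorizontalLift γ B c ∧
      c 0 = p ∧ c 1 = f.toFun p

/-- The parallel transport `A(e)` from the fibre over the beginning point of `e` to the fibre over
its end point (it exists and is unique for every connection and every edge). -/
noncomputable def Connection.transport (A : Connection 𝔓) (e : Edge D m M) :
    𝔓.FiberIso e.source e.target :=
  Classical.epsilon (A.IsParallelTransport e)

/-! ### Cylindrical functions -/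

/-- Smoothness of a function on a finite product `𝒜_{e₁} × … × 𝒜_{eₙ}`, where each factor `𝒜_e` (the
set of bundle isomorphisms between the fibres over the beginning and the end of `e`) carries
the manifold structure that is transported from `G` by the gauge maps. -/
def IsSmoothOnProduct {ι : Type} [Fintype ι] (e : ι → Edge D m M)
    (ψ : (∀ i, 𝔓.FiberIso (e i).source (e i).target) → ℂ) : Prop :=
  ∀ (p : ∀ i, 𝔓.Fiber (e i).source) (q : ∀ i, 𝔓.Fiber (e i).target),
    ContMDiff (ModelWithCorners.pi fun _ : ι => 𝓡 d) 𝓘(ℝ, ℂ) ∞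
      (fun g : ι → G => ψ fun i => (𝔓.gaugeMap (p i) (q i)).symm (g i))

/-- `Ψ` is cylindrical: `Ψ(A) = ψ(A(e₁), …, A(eₙ))` for finitely many edges and a smooth `ψ`. -/
def IsCylindrical (Ψ : Connection 𝔓 → ℂ) : Prop :=
  ∃ (ι : Type) (_ : Fintype ι) (e : ι → Edge D m M)
    (ψ : (∀ i, 𝔓.FiberIso (e i).source (e i).target) → ℂ),
    IsSmoothOnProduct e ψ ∧ ∀ A : Connection 𝔓, Ψ A = ψ fun i => A.transport (e i)

/-- Reindexing maps between powers of `G` are smooth. -/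
theorem contMDiff_reindex {d : ℕ} {G : Type*} [TopologicalSpace G]
    [ChartedSpace (EuclideanSpace ℝ (Fin d)) G] {ι κ : Type} [Fintype ι] [Fintype κ] (f : κ → ι) :
    ContMDiff (ModelWithCorners.pi fun _ : ι => 𝓡 d) (ModelWithCorners.pi fun _ : κ => 𝓡 d) ∞
      (fun (g : ι → G) (k : κ) => g (f k)) := by
  intro g
  rw [contMDiffAt_iff]
  refine ⟨(continuous_pi fun k => continuous_apply (f k)).continuousAt, ?_⟩
  have h : ContDiffWithinAt ℝ ∞
      (fun (x : ι → EuclideanSpace ℝ (Fin d)) (k : κ) => x (f k))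
      (range (ModelWithCorners.pi fun _ : ι => 𝓡 d))
      (extChartAt (ModelWithCorners.pi fun _ : ι => 𝓡 d) g g) := by
    refine ContDiff.contDiffWithinAt ?_
    exact contDiff_pi.2 fun k => contDiff_apply ℝ (EuclideanSpace ℝ (Fin d)) (f k)
  refine h.congr_of_eventuallyEq_of_mem ?_ (mem_range_self _)
  have ht := extChartAt_target_mem_nhdsWithin (I := ModelWithCorners.pi fun _ : ι => 𝓡 d) g
  filter_upwards [ht] with x hx
  have hr := (extChartAt (ModelWithCorners.pi fun _ : ι => 𝓡 d) g).right_inv hx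
  funext k
  exact congrFun hr (f k)

/-- The class of cylindrical functions is closed under pointwise smooth operations. -/
theorem IsCylindrical.comp₂ {φ : ℂ → ℂ → ℂ} (hφ : ContDiff ℝ ∞ fun z : ℂ × ℂ => φ z.1 z.2)
    {Ψ₁ Ψ₂ : Connection 𝔓 → ℂ} (h₁ : IsCylindrical Ψ₁) (h₂ : IsCylindrical Ψ₂) :
    IsCylindrical fun A => φ (Ψ₁ A) (Ψ₂ A) := by
  obtain ⟨ι₁, _, e₁, ψ₁, s₁, h₁⟩ := h₁
  obtain ⟨ι₂, _, e₂, ψ₂, s₂, h₂⟩ := h₂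
  refine ⟨ι₁ ⊕ ι₂, inferInstance, Sum.elim e₁ e₂,
    fun f => φ (ψ₁ fun i => f (Sum.inl i)) (ψ₂ fun i => f (Sum.inr i)), ?_, fun A => ?_⟩
  · intro p q
    have k₁ := (s₁ (fun i => p (Sum.inl i)) (fun i => q (Sum.inl i))).comp
      (contMDiff_reindex (Sum.inl : ι₁ → ι₁ ⊕ ι₂))
    have k₂ := (s₂ (fun i => p (Sum.inr i)) (fun i => q (Sum.inr i))).comp
      (contMDiff_reindex (Sum.inr : ι₂ → ι₁ ⊕ ι₂))
    exact hφ.contMDiff.comp (k₁.prodMk_space k₂)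
  · simp only [h₁, h₂]
    rfl

theorem isCylindrical_const (z : ℂ) : IsCylindrical fun _ : Connection 𝔓 => z :=
  ⟨PEmpty, inferInstance, PEmpty.elim, fun _ => z, fun _ _ => contMDiff_const, fun _ => rfl⟩

/-- If `G` is compact, every cylindrical function is bounded. -/
theorem IsCylindrical.bddAbove [CompactSpace G] {Ψ : Connection 𝔓 → ℂ} (h : IsCylindrical Ψ) :
    BddAbove (range fun A => ‖Ψ A‖) := by
  obtain ⟨ι, _, e, ψ, s, h⟩ := h
  have k := (s (fun i => (𝔓.fiber_nonempty (e i).source).some)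
    (fun i => (𝔓.fiber_nonempty (e i).target).some)).continuous.norm
  obtain ⟨C, hC⟩ := (isCompact_range k).bddAbove
  refine ⟨C, ?_⟩
  rintro _ ⟨A, rfl⟩
  refine hC ⟨fun i => 𝔓.gaugeMap (𝔓.fiber_nonempty (e i).source).some
    (𝔓.fiber_nonempty (e i).target).some (A.transport (e i)), ?_⟩
  simp only [Equiv.symm_apply_apply, h]

/-- The cylindrical functions as a `*`-subalgebra of the algebra of all complex valued functions
on the space of connections; the involution is complex conjugation. -/
def cylSubalgebra (𝔓 : PrincipalBundle m D d G M P) : StarSubalgebra ℂ (Connection 𝔓 → ℂ) where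
  carrier := {Ψ | IsCylindrical Ψ}
  mul_mem' h₁ h₂ := h₁.comp₂ contDiff_mul h₂
  add_mem' h₁ h₂ := h₁.comp₂ contDiff_add h₂
  algebraMap_mem' z := isCylindrical_const z
  star_mem' h := h.comp₂ (φ := fun z _ => star z)
    (Complex.conjCLE.contDiff.comp contDiff_fst) h

/-- The `*`-algebra `Cyl` of cylindrical functions. -/
def Cyl (𝔓 : PrincipalBundle m D d G M P) : Type _ := cylSubalgebra 𝔓

namespace Cyl

noncomputable instance : CommRing (Cyl 𝔓) := inferInstanceAs (CommRing (cylSubalgebra 𝔓))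
noncomputable instance : Algebra ℂ (Cyl 𝔓) := inferInstanceAs (Algebra ℂ (cylSubalgebra 𝔓))
noncomputable instance : StarRing (Cyl 𝔓) := inferInstanceAs (StarRing (cylSubalgebra 𝔓))
instance : StarModule ℂ (Cyl 𝔓) := inferInstanceAs (StarModule ℂ (cylSubalgebra 𝔓))

instance : CoeFun (Cyl 𝔓) fun _ => Connection 𝔓 → ℂ := ⟨fun Ψ => Subtype.val Ψ⟩

/-- The supremum norm on `Cyl`. -/
noncomputable def supNorm (Ψ : Cyl 𝔓) : ℝ := ⨆ A : Connection 𝔓, ‖Ψ A‖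

theorem norm_apply_le_supNorm [CompactSpace G] (Ψ : Cyl 𝔓) (A : Connection 𝔓) :
    ‖Ψ A‖ ≤ supNorm Ψ :=
  le_ciSup (IsCylindrical.bddAbove Ψ.2) A

theorem supNorm_nonneg (Ψ : Cyl 𝔓) : 0 ≤ supNorm Ψ := Real.iSup_nonneg fun _ => norm_nonneg _

theorem supNorm_le {Ψ : Cyl 𝔓} {C : ℝ} (hC : 0 ≤ C) (h : ∀ A, ‖Ψ A‖ ≤ C) : supNorm Ψ ≤ C :=
  Real.iSup_le h hC

noncomputable instance [CompactSpace G] : NormedAddCommGroup (Cyl 𝔓) :=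
  AddGroupNorm.toNormedAddCommGroup
    { toFun := supNorm
      map_zero' := le_antisymm (supNorm_le le_rfl fun _ => norm_zero.le) (supNorm_nonneg _)
      add_le' := fun Ψ Φ => supNorm_le (add_nonneg (supNorm_nonneg _) (supNorm_nonneg _)) fun A =>
        (norm_add_le (Ψ A) (Φ A)).trans
          (add_le_add (norm_apply_le_supNorm Ψ A) (norm_apply_le_supNorm Φ A))
      neg' := fun Ψ => congrArg iSup (funext fun A => norm_neg (Ψ A))
      eq_zero_of_map_eq_zero' := fun Ψ h => Subtype.ext <| funext fun A =>
        norm_le_zero_iff.1 ((norm_apply_le_supNorm Ψ A).trans h.le) }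

noncomputable instance [CompactSpace G] : NormedCommRing (Cyl 𝔓) where
  __ := (inferInstance : NormedAddCommGroup (Cyl 𝔓))
  __ := (inferInstance : CommRing (Cyl 𝔓))
  norm_mul_le Ψ Φ := supNorm_le (mul_nonneg (supNorm_nonneg _) (supNorm_nonneg _)) fun A =>
    (norm_mul_le (Ψ A) (Φ A)).trans
      (mul_le_mul (norm_apply_le_supNorm Ψ A) (norm_apply_le_supNorm Φ A) (norm_nonneg _) (supNorm_nonneg _))

noncomputable instance [CompactSpace G] : NormedAlgebra ℂ (Cyl 𝔓) where
  norm_smul_le z Ψ := supNorm_le (mul_nonneg (norm_nonneg _) (supNorm_nonneg _)) fun A =>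
    (norm_smul_le z (Ψ A)).trans (mul_le_mul_of_nonneg_left (norm_apply_le_supNorm Ψ A) (norm_nonneg _))

instance [CompactSpace G] : CStarRing (Cyl 𝔓) where
  norm_mul_self_le Ψ := by
    have h : supNorm Ψ ≤ √(supNorm (star Ψ * Ψ)) := supNorm_le (Real.sqrt_nonneg _) fun A => by
      refine Real.le_sqrt_of_sq_le ?_
      rw [sq, ← CStarRing.norm_star_mul_self]
      exact norm_apply_le_supNorm (star Ψ * Ψ) A
    calc supNorm Ψ * supNorm Ψ ≤ √(supNorm (star Ψ * Ψ)) * √(supNorm (star Ψ * Ψ)) :=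
          mul_self_le_mul_self (supNorm_nonneg _) h
      _ = ‖star Ψ * Ψ‖ := Real.mul_self_sqrt (supNorm_nonneg _)

end Cyl

end Bundle

/-! ### The completion of a normed `*`-algebra, and states -/

section Completion

open UniformSpace

variable {A : Type*} [NormedCommRing A] [StarRing A] [CStarRing A]

/-- The involution on the completion: the continuous extension of the given one. -/
noncomputable instance : Star (Completion A) := ⟨Completion.map star⟩

theorem completion_coe_star (a : A) :
    ((star a : A) : Completion A) = star (a : Completion A) :=
  (Completion.map_coe star_isometry.uniformContinuous a).symm

theorem completion_continuous_star {A : Type*} [NormedCommRing A] [StarRing A] :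
    Continuous (star : Completion A → Completion A) :=
  Completion.continuous_map

noncomputable instance : StarRing (Completion A) where
  star_involutive x := by
    induction x using Completion.induction_on with
    | hp =>
      exact isClosed_eq (completion_continuous_star.comp completion_continuous_star) continuous_id
    | ih a =>
      rw [← completion_coe_star, ← completion_coe_star, star_star]
  star_mul x y := by
    induction x, y using Completion.induction_on₂ with
    | hp =>
      exact isClosed_eq (completion_continuous_star.comp continuous_mul)
        ((completion_continuous_star.comp continuous_snd).mul
          (completion_continuous_star.comp continuous_fst))
    | ih a b =>
      rw [← Completion.coe_mul, ← completion_coe_star, star_mul, Completion.coe_mul,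
        completion_coe_star, completion_coe_star]
  star_add x y := by
    induction x, y using Completion.induction_on₂ with
    | hp =>
      exact isClosed_eq (completion_continuous_star.comp continuous_add)
        ((completion_continuous_star.comp continuous_fst).add
          (completion_continuous_star.comp continuous_snd))
    | ih a b =>
      rw [← Completion.coe_add, ← completion_coe_star, star_add, Completion.coe_add,
        completion_coe_star, completion_coe_star]

instance : CStarRing (Completion A) where
  norm_mul_self_le x := by
    induction x using Completion.induction_on with
    | hp =>
      exact isClosed_le (continuous_norm.mul continuous_norm)
        (continuous_norm.comp (completion_continuous_star.mul continuous_id))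
    | ih a =>
      rw [← completion_coe_star, ← Completion.coe_mul, Completion.norm_coe,
        Completion.norm_coe, CStarRing.norm_star_mul_self]

instance [NormedAlgebra ℂ A] [StarModule ℂ A] : StarModule ℂ (Completion A) where
  star_smul z x := by
    induction x using Completion.induction_on with
    | hp =>
      exact isClosed_eq (completion_continuous_star.comp (continuous_const_smul z))
        (completion_continuous_star.const_smul (star z))
    | ih a =>
      rw [← Completion.coe_smul, ← completion_coe_star, star_smul, Completion.coe_smul,
        completion_coe_star]

/-- The completion of a normed `*`-algebra with the `C*`-identity is a `C*`-algebra. -/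
noncomputable instance [NormedAlgebra ℂ A] [StarModule ℂ A] :
    CommCStarAlgebra (Completion A) where

end Completion

/-- A state on a unital complex `*`-algebra: a linear functional `φ` with `φ(a*)` the complex
conjugate of `φ(a)`, with `φ(a* a) ≥ 0` and with `φ(1) = 1`. -/
structure IsState {A : Type*} [Ring A] [StarRing A] [Module ℂ A] (φ : A →ₗ[ℂ] ℂ) : Prop where
  map_star : ∀ a : A, φ (star a) = starRingEnd ℂ (φ a)
  nonneg : ∀ a : A, 0 ≤ (φ (star a * a)).re ∧ (φ (star a * a)).im = 0
  map_one : φ 1 = 1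

end HolonomyFlux

namespace HolonomyFlux

/-! The bound comes from having enough squares in `Cyl`. `Cyl` is not complete, so the continuous
functional calculus of a C*-algebra is not at hand, but it is closed under composition with smooth
functions. If `Ψ` is real and `c > ‖Ψ‖`, the values of `c - Ψ` stay in a closed half-line of
positive numbers, where the square root is smooth; hence `c - Ψ = S* S` with `S` in `Cyl`, by
`Cyl.exists_star_mul_self_eq_sub`. Positivity gives `φ(Ψ) ≤ c`, and letting `c` decrease to `‖Ψ‖`
and using `-Ψ` as well gives `|φ(Ψ)| ≤ ‖Ψ‖`. A general `Ψ` is split into real and imaginary parts,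
which costs the factor 2.

The extension exists by density and continuity, and the state axioms are closed conditions, so they
survive the passage to the completion. Uniqueness is asked among all states, not only the continuous
ones; it rests on the automatic continuity of positive functionals on a C*-algebra
(`IsState.continuous`). -/

/-- A real function that is smooth on the whole line, agreeing with `t ↦ √(c - t)` on
`(-∞, K]` when `K < c`. -/
theorem exists_contDiff_eq_sqrt_sub {K c : ℝ} (hKc : K < c) :
    ∃ f : ℝ → ℝ, ContDiff ℝ ∞ f ∧ ∀ t ≤ K, f t * f t = c - t := by
  -- The cutoff `χ` is 1 for `t ≤ K` and 0 for `t ≥ c`. Thus `h` interpolates between `c - t` and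
  -- the constant 1, switching to 1 entirely before `c - t` can turn negative. It is positive
  -- everywhere, so its square root is smooth on the whole line.
  set χ : ℝ → ℝ := fun t => Real.smoothTransition ((c - t) / (c - K))
  set h : ℝ → ℝ := fun t => (c - t) * χ t + (1 - χ t) with hh
  have hcK : 0 < c - K := sub_pos.2 hKc
  have χ_smooth : ContDiff ℝ ∞ χ :=
    Real.smoothTransition.contDiff.comp ((contDiff_const.sub contDiff_id).div_const _)
  have h_smooth : ContDiff ℝ ∞ h :=
    ((contDiff_const.sub contDiff_id).mul χ_smooth).add (contDiff_const.sub χ_smooth)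
  have h_pos : ∀ t, 0 < h t := by
    intro t
    rcases lt_or_ge t c with ht | ht
    · have hct : 0 < c - t := sub_pos.2 ht
      have χ_pos : 0 < χ t := Real.smoothTransition.pos_of_pos (div_pos hct hcK)
      have χ_le : χ t ≤ 1 := Real.smoothTransition.le_one _
      exact add_pos_of_pos_of_nonneg (mul_pos hct χ_pos) (sub_nonneg.2 χ_le)
    · have χ_zero : χ t = 0 := Real.smoothTransition.zero_of_nonpos
        (div_nonpos_of_nonpos_of_nonneg (sub_nonpos.2 ht) hcK.le)
      simp [hh, χ_zero]
  refine ⟨fun t => √(h t), h_smooth.sqrt fun t => (h_pos t).ne', fun t ht => ?_⟩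
  have χ_one : χ t = 1 := Real.smoothTransition.one_of_one_le
    ((one_le_div hcK).2 (sub_le_sub_left ht c))
  rw [Real.mul_self_sqrt (h_pos t).le]
  simp [hh, χ_one]

/-! ### The norm bound for states on `Cyl` -/

section StateBound

variable {m D d : ℕ} {G M P : Type*}
  [Group G] [TopologicalSpace G] [ChartedSpace (EuclideanSpace ℝ (Fin d)) G]
  [TopologicalSpace M] [ChartedSpace (EuclideanSpace ℝ (Fin D)) M]
  [TopologicalSpace P]
  [ChartedSpace (ModelProd (EuclideanSpace ℝ (Fin D)) (EuclideanSpace ℝ (Fin d))) P]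
  [MulAction Gᵐᵒᵖ P] {𝔓 : PrincipalBundle m D d G M P} [CompactSpace G]

/-- For a real valued cylindrical function `Ψ` and `c > ‖Ψ‖`, the function `c - Ψ` is the square
of a real valued cylindrical function. -/
theorem Cyl.exists_star_mul_self_eq_sub {Ψ : Cyl 𝔓} (hΨ : IsSelfAdjoint Ψ) {c : ℝ}
    (hc : ‖Ψ‖ < c) : ∃ S : Cyl 𝔓, star S * S = algebraMap ℂ (Cyl 𝔓) c - Ψ := by
  obtain ⟨f, hf, hfc⟩ := exists_contDiff_eq_sqrt_sub hc
  -- `IsCylindrical.comp₂` takes binary operations; here the second argument is a dummy, filled with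
  -- `Ψ` again.
  have smooth : ContDiff ℝ ∞ fun z : ℂ × ℂ => ((f z.1.re : ℝ) : ℂ) :=
    Complex.ofRealCLM.contDiff.comp (hf.comp (Complex.reCLM.contDiff.comp contDiff_fst))
  refine ⟨⟨fun A => ((f (Ψ A).re : ℝ) : ℂ),
    IsCylindrical.comp₂ (φ := fun z _ => ((f z.re : ℝ) : ℂ)) smooth Ψ.2 Ψ.2⟩, ?_⟩
  refine Subtype.ext (funext fun A => ?_)
  have real : (((Ψ A).re : ℝ) : ℂ) = Ψ A :=
    Complex.conj_eq_iff_re.1 (congrFun (congrArg Subtype.val hΨ.star_eq) A)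
  -- The identity for `f * f` is available only up to `‖Ψ‖`, and all values of `Ψ` lie there.
  have bound : (Ψ A).re ≤ ‖Ψ‖ :=
    (Complex.re_le_norm _).trans (Cyl.norm_apply_le_supNorm Ψ A)
  change (starRingEnd ℂ) ((f (Ψ A).re : ℝ) : ℂ) * ((f (Ψ A).re : ℝ) : ℂ) = (c : ℂ) - Ψ A
  rw [Complex.conj_ofReal, ← Complex.ofReal_mul, hfc _ bound, Complex.ofReal_sub, real]

/-- Positivity on `c - Ψ = S* S`, together with `φ 1 = 1`, gives `(φ Ψ).re ≤ c`. The strict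
inequality `c > ‖Ψ‖` keeps the square root away from its singularity at 0; the limit in `c` is taken
only afterwards. -/
theorem IsState.re_le_norm {φ : Cyl 𝔓 →ₗ[ℂ] ℂ} (hφ : IsState φ) {Ψ : Cyl 𝔓}
    (hΨ : IsSelfAdjoint Ψ) : (φ Ψ).re ≤ ‖Ψ‖ := by
  refine le_of_forall_gt_imp_ge_of_dense fun c hc => ?_
  obtain ⟨S, hS⟩ := Cyl.exists_star_mul_self_eq_sub hΨ hc
  have nonneg := (hφ.nonneg S).1
  rw [hS, Algebra.algebraMap_eq_smul_one, map_sub, map_smul, hφ.map_one] at nonneg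
  simpa using nonneg

/-- A state on `Cyl` is bounded by the norm on real valued functions. -/
theorem IsState.norm_apply_le_of_isSelfAdjoint {φ : Cyl 𝔓 →ₗ[ℂ] ℂ} (hφ : IsState φ)
    {Ψ : Cyl 𝔓} (hΨ : IsSelfAdjoint Ψ) : ‖φ Ψ‖ ≤ ‖Ψ‖ := by
  have real : (((φ Ψ).re : ℝ) : ℂ) = φ Ψ := by
    rw [← Complex.conj_eq_iff_re, ← hφ.map_star, hΨ.star_eq]
  have neg := hφ.re_le_norm hΨ.neg
  rw [map_neg, norm_neg, Complex.neg_re] at neg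
  rw [← real, Complex.norm_real, Real.norm_eq_abs]
  exact abs_le.2 ⟨neg_le.1 neg, hφ.re_le_norm hΨ⟩

/-- The real and imaginary parts of `Ψ` each have norm at most `‖Ψ‖`, and their contributions are
simply added. The constant 2 is not optimal: Cauchy–Schwarz applied to `φ(Ψ* Ψ)` would give 1. -/
theorem IsState.norm_apply_le_two_mul {φ : Cyl 𝔓 →ₗ[ℂ] ℂ} (hφ : IsState φ) (Ψ : Cyl 𝔓) :
    ‖φ Ψ‖ ≤ 2 * ‖Ψ‖ := by
  have hre := (hφ.norm_apply_le_of_isSelfAdjoint (realPart Ψ).2).trans (realPart.norm_le Ψ)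
  have him := (hφ.norm_apply_le_of_isSelfAdjoint (imaginaryPart Ψ).2).trans
    (imaginaryPart.norm_le Ψ)
  calc ‖φ Ψ‖ = ‖φ (realPart Ψ : Cyl 𝔓) + Complex.I • φ (imaginaryPart Ψ : Cyl 𝔓)‖ := by
        rw [← map_smul, ← map_add, realPart_add_I_smul_imaginaryPart]
    _ ≤ ‖φ (realPart Ψ : Cyl 𝔓)‖ + ‖φ (imaginaryPart Ψ : Cyl 𝔓)‖ := by
        refine (norm_add_le _ _).trans_eq ?_
        rw [norm_smul, Complex.norm_I, one_mul]
    _ ≤ 2 * ‖Ψ‖ := by linarith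

end StateBound

/-! ### Extension of states to the completion -/

section Extension

open UniformSpace ComplexOrder

/-- A state on a unital `C*`-algebra is continuous. -/
theorem IsState.continuous {A : Type*} [CStarAlgebra A] {φ : A →ₗ[ℂ] ℂ} (hφ : IsState φ) :
    Continuous φ := by
  -- In the spectral order the nonnegative elements are exactly the `y* y`, so a state is a positive
  -- map in the order sense, and positive maps on a C*-algebra are automatically bounded.
  let _ := CStarAlgebra.spectralOrder A
  have _ := CStarAlgebra.spectralOrderedRing A
  have pos : ∀ x : A, 0 ≤ x → 0 ≤ φ x := by
    intro x hx
    obtain ⟨y, rfl⟩ := CStarAlgebra.nonneg_iff_eq_star_mul_self.1 hx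
    exact Complex.nonneg_iff.2 ⟨(hφ.nonneg y).1, (hφ.nonneg y).2.symm⟩
  obtain ⟨C, hC⟩ := (PositiveLinearMap.mk₀ φ pos).exists_norm_apply_le
  exact (φ.mkContinuous C hC).continuous

variable {A : Type*} [NormedCommRing A] [StarRing A] [CStarRing A] [NormedAlgebra ℂ A]

/-- A linear functional on the completion that is continuous and restricts to a state is a
state. -/
theorem IsState.of_completion {φ : A →ₗ[ℂ] ℂ} (hφ : IsState φ)
    {φbar : Completion A →ₗ[ℂ] ℂ} (cont : Continuous φbar)
    (ext : ∀ a : A, φbar a = φ a) : IsState φbar where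
  map_star x := by
    -- Both sides are continuous in `x`, so it suffices to compare them on the dense image of `A`.
    induction x using Completion.induction_on with
    | hp =>
      exact isClosed_eq (cont.comp completion_continuous_star)
        (Complex.continuous_conj.comp cont)
    | ih a => rw [← completion_coe_star, ext, ext, hφ.map_star]
  nonneg x := by
    have sq : Continuous fun x : Completion A => φbar (star x * x) :=
      cont.comp (completion_continuous_star.mul continuous_id)
    induction x using Completion.induction_on with
    | hp =>
      exact (isClosed_le continuous_const (Complex.continuous_re.comp sq)).inter
        (isClosed_eq (Complex.continuous_im.comp sq) continuous_const)
    | ih a =>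
      rw [← completion_coe_star, ← Completion.coe_mul, ext]
      exact hφ.nonneg a
  map_one := by rw [← Completion.coe_one, ext, hφ.map_one]

/-- A continuous state on a normed `*`-algebra with the `C*`-identity has a unique extension to a
state on the completion. -/
theorem IsState.existsUnique_completion [StarModule ℂ A] {φ : A →ₗ[ℂ] ℂ} (hφ : IsState φ)
    (cont : Continuous φ) :
    ∃! φbar : Completion A →ₗ[ℂ] ℂ, IsState φbar ∧ ∀ a : A, φbar a = φ a := by
  let φc : A →L[ℂ] ℂ := ⟨φ, cont⟩
  let φbar : Completion A →L[ℂ] ℂ := φc.extend (Completion.toComplL : A →L[ℂ] Completion A)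
  have ext : ∀ a : A, φbar a = φ a := fun a =>
    φc.extend_eq (e := (Completion.toComplL : A →L[ℂ] Completion A))
      Completion.denseRange_coe (Completion.isUniformInducing_coe A) a
  refine ⟨φbar, ⟨hφ.of_completion φbar.continuous ext, ext⟩, fun χ hχ => ?_⟩
  refine LinearMap.ext fun x => ?_
  induction x using Completion.induction_on with
  -- The competitor `χ` is only assumed to be a state; its continuity is what makes agreement on the
  -- dense image of `A` decisive.
  | hp => exact isClosed_eq hχ.1.continuous φbar.continuous
  | ih a => exact (hχ.2 a).trans (ext a).symm

end Extension

end HolonomyFlux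

theorem mainTheorem6 {m D d : ℕ} (hm : 1 ≤ m)
    {G : Type*} [Group G] [TopologicalSpace G] [ChartedSpace (EuclideanSpace ℝ (Fin d)) G]
    [LieGroup (𝓡 d) ω G] [CompactSpace G] [ConnectedSpace G]
    {M : Type*} [TopologicalSpace M] [ChartedSpace (EuclideanSpace ℝ (Fin D)) M]
    [HolonomyFlux.SemianalyticManifold (𝓡 D) m M] [T2Space M] [SecondCountableTopology M]
    {P : Type*} [TopologicalSpace P]
    [ChartedSpace (ModelProd (EuclideanSpace ℝ (Fin D)) (EuclideanSpace ℝ (Fin d))) P]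
    [HolonomyFlux.SemianalyticManifold ((𝓡 D).prod (𝓡 d)) m P] [MulAction Gᵐᵒᵖ P]
    (𝔓 : HolonomyFlux.PrincipalBundle m D d G M P)
    (φ : HolonomyFlux.Cyl 𝔓 →ₗ[ℂ] ℂ) (hφ : HolonomyFlux.IsState φ) :
    (∀ Ψ : HolonomyFlux.Cyl 𝔓, ‖φ Ψ‖ ≤ 2 * ‖Ψ‖) ∧
    Continuous φ ∧
    ∃! φbar : UniformSpace.Completion (HolonomyFlux.Cyl 𝔓) →ₗ[ℂ] ℂ,
      HolonomyFlux.IsState φbar ∧ ∀ Ψ : HolonomyFlux.Cyl 𝔓, φbar Ψ = φ Ψ := by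
  have bound := hφ.norm_apply_le_two_mul
  have cont : Continuous φ := (φ.mkContinuous 2 bound).continuous
  exact ⟨bound, cont, hφ.existsUnique_completion cont⟩
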